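/- An operator $A:\mathbb{R}^n\rightrightarrows\mathbb{R}^n$ is a \emph{linear relation} if its graph $\operatorname{gra}A=\{(x,x^*):x^*\in Ax\}$ is a linear subspace of $\mathbb{R}^n\times\mathbb{R}^n$; it is \emph{monotone} if $\langle x^*-y^*,x-y\rangle\ge 0$ for all $(x,x^*),(y,y^*)\in\operatorname{gra}A$, \emph{maximally monotone} if moreover no monotone operator has a strictly larger graph, and \emph{symmetric} if $\langle x,y^*\rangle=\langle y,x^*\rangle$ for all $(x,x^*),(y,y^*)\in\operatorname{gra}A$. For a monotone linear relation $A$ put $q_A(x)=\tfrac12\langle x,x^*\rangle$ for any $x^*\in Ax$ (the value does not depend on $x^*$) if $Ax\neq\varnothing$, and $q_A(x)=\infty$ if $Ax=\varnothing$. A sequence $f_k:\mathbb{R}^n\to[-\infty,\infty]$ \emph{epiconverges} to $f$, written $f_k\overset{e}{\to}f$, if the outer limit and the inner limit of the sets $\operatorname{epi}f_k=\{(x,r)\in\mathbb{R}^n\times\mathbb{R}: f_k(x)\le r\}$ both equal $\operatorname{epi}f$. A function $f$ is \emph{proper} if it never takes the value $-\infty$ and is not identically $\infty$. \textbf{Proposition.}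 (i) For all $k\in\mathbb{N}$, let $f_k=q_{A_k}(\cdot-a_k)+\langle b_k,\cdot\rangle+c_k$, where $A_k$ is a maximally monotone symmetric linear relation on $\mathbb{R}^n$, $a_k,b_k\in\mathbb{R}^n$ and $c_k\in\mathbb{R}$. Suppose that $f_k\overset{e}{\to}f$ and that $f$ is proper. Then $f=q_A(\cdot-a)+\langle b,\cdot\rangle+c$ for some maximally monotone symmetric linear relation $A$ on $\mathbb{R}^n$, some $a,b\in\mathbb{R}^n$ and some $c\in\mathbb{R}$. (ii) For all $k\in\mathbb{N}$, let $f_k=q_{A_k}+c_k$, where $A_k$ is a maximally monotone symmetric linear relation on $\mathbb{R}^n$ and $c_k\in\mathbb{R}$. Suppose that $f_k\overset{e}{\to}f$ and that $f$ is proper. Then $f=q_A+c$ for some maximally monotone symmetric linear relation $A$ on $\mathbb{R}^n$ and some $c\in\mathbb{R}$. -/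

import Mathlib

open Filter Topology
open scoped InnerProductSpace

namespace EpiQuad

/-- Euclidean space `ℝⁿ` with its usual inner product. -/
abbrev Rn (n : ℕ) : Type := EuclideanSpace ℝ (Fin n)

/-- A set-valued operator `A : ℝⁿ ⇉ ℝⁿ`, identified with its graph:
`(x, u) ∈ A` means `u ∈ A x`. Its domain is `A.dom`. -/
abbrev Op (n : ℕ) : Type := SetRel (Rn n) (Rn n)

variable {n : ℕ}

/-- The graph is a linear subspace of `ℝⁿ × ℝⁿ`. -/
def IsLinearRelation (A : Op n) : Prop :=
  ∃ S : Submodule ℝ (Rn n × Rn n), (S : Set (Rn n × Rn n)) = A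

/-- Monotonicity: `⟨u - v, x - y⟩ ≥ 0` whenever `u ∈ A x` and `v ∈ A y`. -/
def IsMonotone (A : Op n) : Prop :=
  ∀ x u y v : Rn n, (x, u) ∈ A → (y, v) ∈ A → 0 ≤ ⟪u - v, x - y⟫_ℝ

/-- Maximal monotonicity: the graph is maximal, for inclusion, among the graphs of all
monotone operators (linear or not). -/
def IsMaximallyMonotone (A : Op n) : Prop :=
  IsMonotone A ∧ ∀ B : Op n, IsMonotone B → (∀ p, p ∈ A → p ∈ B) → B = A

/-- The adjoint: `(w, v) ∈ A*` iff `⟨y, v⟩ = ⟨u, w⟩` for all `(y, u)` in the graph of `A`. -/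
def adjoint (A : Op n) : Op n :=
  {p | ∀ y u : Rn n, (y, u) ∈ A → ⟪y, p.2⟫_ℝ = ⟪u, p.1⟫_ℝ}

/-- `A` is symmetric if its graph is contained in the graph of its adjoint. -/
def IsSymmetric (A : Op n) : Prop :=
  ∀ p, p ∈ A → p ∈ adjoint A

/-- Maximally monotone symmetric linear relations. -/
structure IsMaxMonoSymmLinRel (A : Op n) : Prop where
  linear : IsLinearRelation A
  maximallyMonotone : IsMaximallyMonotone A
  symmetric : IsSymmetric A

open Classical in
/-- The function `q_A`, with values in the extended reals: `q_A x = ½⟨x, u⟩` for any `u ∈ A x` if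
`x ∈ dom A`, and `q_A x = ∞` otherwise. For monotone linear relations the choice of `u` does not
matter, see `q_eq`. -/
noncomputable def q (A : Op n) (x : Rn n) : EReal :=
  if h : ∃ u, (x, u) ∈ A then ((1 / 2 * ⟪x, h.choose⟫_ℝ : ℝ) : EReal) else ⊤

/-- For a monotone linear relation, `⟨x, A x⟩` is single-valued on the domain of `A`. -/
theorem inner_eq_of_mem {A : Op n} (hl : IsLinearRelation A) (hm : IsMonotone A)
    {x u v : Rn n} (hu : (x, u) ∈ A) (hv : (x, v) ∈ A) : ⟪x, u⟫_ℝ = ⟪x, v⟫_ℝ := by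
  obtain ⟨S, rfl⟩ := hl
  have key : ∀ w : Rn n, ((0 : Rn n), w) ∈ S → 0 ≤ ⟪x, w⟫_ℝ := by
    intro w hw
    by_contra hneg
    push Not at hneg
    set t : ℝ := (⟪u, x⟫_ℝ + 1) / -⟪x, w⟫_ℝ with ht
    have h1 : (x, u + t • w) ∈ S := by
      have := S.add_mem hu (S.smul_mem t hw)
      simpa using this
    have h2 := hm x (u + t • w) 0 0 h1 S.zero_mem
    rw [sub_zero, sub_zero, inner_add_left, real_inner_smul_left, real_inner_comm x w] at h2
    have h3 : t * ⟪x, w⟫_ℝ = -(⟪u, x⟫_ℝ + 1) := by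
      rw [ht]; field_simp [hneg.ne]
    linarith
  have d1 : ((0 : Rn n), u - v) ∈ S := by simpa using S.sub_mem hu hv
  have d2 : ((0 : Rn n), v - u) ∈ S := by simpa using S.sub_mem hv hu
  have e1 := key _ d1
  have e2 := key _ d2
  rw [inner_sub_right] at e1 e2
  linarith

theorem q_eq {A : Op n} (hl : IsLinearRelation A) (hm : IsMonotone A)
    {x u : Rn n} (hu : (x, u) ∈ A) : q A x = ((1 / 2 * ⟪x, u⟫_ℝ : ℝ) : EReal) := by
  have h : ∃ u, (x, u) ∈ A := ⟨u, hu⟩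
  rw [q, dif_pos h, inner_eq_of_mem hl hm h.choose_spec hu]

theorem q_eq_top {A : Op n} {x : Rn n} (hx : x ∉ A.dom) : q A x = ⊤ :=
  dif_neg hx

/-- The generalized linear-quadratic function `x ↦ q_A (x - a) + ⟨b, x⟩ + c`. -/
noncomputable def genLinQuad (A : Op n) (a b : Rn n) (c : ℝ) (x : Rn n) : EReal :=
  q A (x - a) + ((⟪b, x⟫_ℝ : ℝ) : EReal) + (c : EReal)

/-- The epigraph, a subset of `ℝⁿ × ℝ`. -/
def epi (f : Rn n → EReal) : Set (Rn n × ℝ) :=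
  {p | f p.1 ≤ (p.2 : EReal)}

/-- A function is proper if it never takes the value `-∞` and is not identically `∞`. -/
def IsProper (f : Rn n → EReal) : Prop :=
  (∀ x, f x ≠ ⊥) ∧ ∃ x, f x ≠ ⊤

/-- The outer limit (limsup) of a sequence of sets: every neighbourhood of the point
meets infinitely many of the sets. -/
def outerLimit {X : Type*} [TopologicalSpace X] (C : ℕ → Set X) : Set X :=
  {p | ∀ U ∈ 𝓝 p, ∃ᶠ k in atTop, (C k ∩ U).Nonempty}

/-- The inner limit (liminf) of a sequence of sets: every neighbourhood of the point
meets all but finitely many of the sets. -/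
def innerLimit {X : Type*} [TopologicalSpace X] (C : ℕ → Set X) : Set X :=
  {p | ∀ U ∈ 𝓝 p, ∀ᶠ k in atTop, (C k ∩ U).Nonempty}

/-- `g` is the lower epilimit of `f`. -/
def IsLowerEpilimit (f : ℕ → Rn n → EReal) (g : Rn n → EReal) : Prop :=
  epi g = outerLimit (fun k => epi (f k))

/-- `g` is the upper epilimit of `f`. -/
def IsUpperEpilimit (f : ℕ → Rn n → EReal) (g : Rn n → EReal) : Prop :=
  epi g = innerLimit (fun k => epi (f k))

/-- The sequence `f` epiconverges to `g`: the lower and the upper epilimit both equal `g`. -/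
def EpiConverges (f : ℕ → Rn n → EReal) (g : Rn n → EReal) : Prop :=
  IsLowerEpilimit f g ∧ IsUpperEpilimit f g

end EpiQuad

/-! Pick `x` with `f x` finite and `p k → x` with `fk k (p k) → f x`. Recentred at `p k`, each `fk
k` is a constant plus a convex function `B k v v + l k v` on a subspace `V k`, so it suffices that
limits of such functions are again of this form. The key estimate is `slope_tendsto_zero`: along a
recovery sequence the derivative in directions `d k → 0` with `B k (d k) (d k)` bounded tends to
zero, since otherwise a step `± t • d k` would go below the epilimit. It yields `recovers_combo`:
linear combinations of recovery sequences are recovery sequences. Hence the domain of the limit is a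
subspace, `B k` and `l k` converge along recovery sequences by polarization, and the limits are a
bilinear and a linear form (`exists_eq_quadExt`). The passage between operators and forms is
`exists_q_eq_quadExt` one way and `relOfForm` the other. When the functions are `q (A k) + c k`, the
centre can be kept at `0`, where no linear term arises. -/

namespace EpiQuad

/-! ### Epilimits of convex quadratic functions on varying subspaces -/

section QuadraticSequences

variable {E : Type*} [NormedAddCommGroup E] [NormedSpace ℝ E]

open Classical in
/-- The function `v ↦ B v v + l v` on the subspace `V`, extended by `∞`. -/
noncomputable def quadExt (V : Submodule ℝ E) (B : V →ₗ[ℝ] V →ₗ[ℝ] ℝ) (l : V →ₗ[ℝ] ℝ)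
    (x : E) : EReal :=
  if h : x ∈ V then ((B ⟨x, h⟩ ⟨x, h⟩ + l ⟨x, h⟩ : ℝ) : EReal) else ⊤

theorem quadExt_of_mem {V : Submodule ℝ E} (B : V →ₗ[ℝ] V →ₗ[ℝ] ℝ) (l : V →ₗ[ℝ] ℝ) (x : V) :
    quadExt V B l x = ((B x x + l x : ℝ) : EReal) :=
  dif_pos x.2

theorem quadExt_of_notMem {V : Submodule ℝ E} (B : V →ₗ[ℝ] V →ₗ[ℝ] ℝ) (l : V →ₗ[ℝ] ℝ) {x : E}
    (hx : x ∉ V) : quadExt V B l x = ⊤ :=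
  dif_neg hx

variable {V : ℕ → Submodule ℝ E} {B : ∀ k, V k →ₗ[ℝ] V k →ₗ[ℝ] ℝ} {l : ∀ k, V k →ₗ[ℝ] ℝ}
  {g : E → EReal}

/-- Sequential form of the statement that the convex functions `quadExt (V k) (B k) (l k)`
epiconverge to `g`, where `g` never takes the value `-∞` and `g 0 = 0`. -/
structure IsQuadEpilimit (B : ∀ k, V k →ₗ[ℝ] V k →ₗ[ℝ] ℝ) (l : ∀ k, V k →ₗ[ℝ] ℝ)
    (g : E → EReal) : Prop where
  symm : ∀ k x y, B k x y = B k y x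
  nonneg : ∀ k x, 0 ≤ B k x x
  ne_bot : ∀ v, g v ≠ ⊥
  zero : g 0 = 0
  lower : ∀ (u : ∀ k, V k) (v : E), Tendsto (fun k => (u k : E)) atTop (𝓝 v) →
    ∀ s : ℝ, (s : EReal) < g v → ∀ᶠ k in atTop, s < B k (u k) (u k) + l k (u k)
  recovery : ∀ v, g v ≠ ⊤ → ∃ u : ∀ k, V k, Tendsto (fun k => (u k : E)) atTop (𝓝 v) ∧
    Tendsto (fun k => B k (u k) (u k) + l k (u k)) atTop (𝓝 (g v).toReal)

/-- `u` is a recovery sequence for `g` at `v`. -/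
structure Recovers (B : ∀ k, V k →ₗ[ℝ] V k →ₗ[ℝ] ℝ) (l : ∀ k, V k →ₗ[ℝ] ℝ)
    (g : E → EReal) (u : ∀ k, V k) (v : E) : Prop where
  tendsto : Tendsto (fun k => (u k : E)) atTop (𝓝 v)
  ne_top : g v ≠ ⊤
  tendsto_val : Tendsto (fun k => B k (u k) (u k) + l k (u k)) atTop (𝓝 (g v).toReal)

namespace IsQuadEpilimit

theorem recovers_zero (h : IsQuadEpilimit B l g) : Recovers B l g (fun _ => 0) 0 where
  tendsto := by simp
  ne_top := by simp [h.zero]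
  tendsto_val := by simp [h.zero]

theorem exists_lt (h : IsQuadEpilimit B l g) (v : E) : ∃ s : ℝ, (s : EReal) < g v := by
  obtain ⟨s, -, hs⟩ := EReal.lt_iff_exists_real_btwn.1 (bot_lt_iff_ne_bot.2 (h.ne_bot v))
  exact ⟨s, hs⟩

/-- Halving the sequence scales `B` by 1/4 and `l` by 1/2, so the lower bound at `v / 2` and the
upper bound at `v` together eliminate `l`. -/
theorem bounded_quad (h : IsQuadEpilimit B l g) {u : ∀ k, V k} {v : E}
    (hu : Recovers B l g u v) : ∃ M : ℝ, ∀ᶠ k in atTop, B k (u k) (u k) ≤ M := by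
  obtain ⟨s, hs⟩ := h.exists_lt ((1 / 2 : ℝ) • v)
  have h1 := h.lower (fun k => (1 / 2 : ℝ) • u k) _ (by simpa using hu.tendsto.const_smul (1 / 2 : ℝ))
    s hs
  refine ⟨2 * ((g v).toReal + 1) - 4 * s, ?_⟩
  filter_upwards [h1, hu.tendsto_val.eventually_lt_const (lt_add_one _)] with k hk hk'
  simp only [map_smul, LinearMap.smul_apply, smul_eq_mul] at hk
  linarith

/-- Both `u + t • d` and `u - t • d` still tend to `v`, so their values cannot fall asymptotically
below `g v`. As `u` attains `g v` in the limit, the first-order term is squeezed up to `t * M`, and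
`t` is arbitrarily small. -/
theorem slope_tendsto_zero (h : IsQuadEpilimit B l g) {u : ∀ k, V k} {v : E}
    (hu : Recovers B l g u v) {d : ∀ k, V k} (hd : Tendsto (fun k => (d k : E)) atTop (𝓝 0))
    {M : ℝ} (hM : ∀ᶠ k in atTop, B k (d k) (d k) ≤ M) :
    Tendsto (fun k => 2 * B k (u k) (d k) + l k (d k)) atTop (𝓝 0) := by
  refine Metric.tendsto_nhds.2 fun δ hδ => ?_
  obtain ⟨t, ht, htM⟩ : ∃ t : ℝ, 0 < t ∧ t * M ≤ δ / 2 := by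
    have hM1 : 0 < |M| + 1 := by positivity
    refine ⟨δ / (2 * (|M| + 1)), by positivity, ?_⟩
    calc δ / (2 * (|M| + 1)) * M ≤ δ / (2 * (|M| + 1)) * (|M| + 1) := by
          gcongr; linarith [le_abs_self M]
      _ = δ / 2 := by field_simp
  -- Two errors of size `t * δ / 4`, from the lower bound and from the recovery, plus `t * δ / 2`
  -- from the quadratic term add up to `t * δ`.
  have hε : 0 < t * δ / 4 := by positivity
  have key : ∀ r : ℝ, ∀ᶠ k in atTop, (g v).toReal - t * δ / 4 <
      B k (u k) (u k) + l k (u k) + r * (2 * B k (u k) (d k) + l k (d k))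
        + r ^ 2 * B k (d k) (d k) := by
    intro r
    have hlim : Tendsto (fun k => ((u k + r • d k : V k) : E)) atTop (𝓝 v) := by
      simpa using hu.tendsto.add (hd.const_smul r)
    have := h.lower (fun k => u k + r • d k) v hlim ((g v).toReal - t * δ / 4) (by
      rw [← EReal.coe_toReal hu.ne_top (h.ne_bot v)]
      exact_mod_cast sub_lt_self _ hε)
    filter_upwards [this] with k hk
    simp only [map_add, map_smul, LinearMap.add_apply, LinearMap.smul_apply, smul_eq_mul,
      h.symm k (d k) (u k)] at hk
    linarith
  filter_upwards [key t, key (-t), hM, hu.tendsto_val.eventually_lt_const (lt_add_of_pos_right _ hε)]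
    with k h1 h2 h3 h4
  have h5 : t ^ 2 * B k (d k) (d k) ≤ t * (δ / 2) := by
    calc t ^ 2 * B k (d k) (d k) ≤ t ^ 2 * M := by gcongr
      _ = t * (t * M) := by ring
      _ ≤ _ := by gcongr
  rw [Real.dist_eq, sub_zero, abs_lt]
  constructor
  · have : 0 < t * (2 * B k (u k) (d k) + l k (d k) + δ) := by linarith
    linarith [pos_of_mul_pos_right this ht.le]
  · have : 0 < t * (δ - (2 * B k (u k) (d k) + l k (d k))) := by linarith
    linarith [pos_of_mul_pos_right this ht.le]

theorem quad_combo_le (h : IsQuadEpilimit B l g) (k : ℕ) (x y : V k) (s t : ℝ) :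
    B k (s • x + t • y) (s • x + t • y) ≤ 2 * s ^ 2 * B k x x + 2 * t ^ 2 * B k y y := by
  -- Parallelogram law: the bound falls short of equality by exactly this term.
  have := h.nonneg k (s • x - t • y)
  simp only [map_add, map_sub, map_smul, LinearMap.add_apply, LinearMap.sub_apply,
    LinearMap.smul_apply, smul_eq_mul, h.symm k y x] at this ⊢
  linarith

theorem bounded_quad_combo (h : IsQuadEpilimit B l g) {u u' : ∀ k, V k}
    (hu : ∃ M : ℝ, ∀ᶠ k in atTop, B k (u k) (u k) ≤ M)
    (hu' : ∃ M : ℝ, ∀ᶠ k in atTop, B k (u' k) (u' k) ≤ M) (s t : ℝ) :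
    ∃ M : ℝ, ∀ᶠ k in atTop, B k (s • u k + t • u' k) (s • u k + t • u' k) ≤ M := by
  obtain ⟨M, hM⟩ := hu
  obtain ⟨M', hM'⟩ := hu'
  refine ⟨2 * s ^ 2 * M + 2 * t ^ 2 * M', ?_⟩
  filter_upwards [hM, hM'] with k hk hk'
  refine (h.quad_combo_le k _ _ s t).trans ?_
  gcongr

theorem bounded_linear (h : IsQuadEpilimit B l g) {u : ∀ k, V k} {v : E}
    (hu : Recovers B l g u v) : ∃ M : ℝ, ∀ᶠ k in atTop, |l k (u k)| ≤ M := by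
  obtain ⟨M, hM⟩ := h.bounded_quad hu
  refine ⟨M + |(g v).toReal| + 1, ?_⟩
  filter_upwards [hM, hu.tendsto_val.eventually_lt_const (lt_add_one _),
    hu.tendsto_val.eventually_const_lt (sub_one_lt _)] with k h1 h2 h3
  have := h.nonneg k (u k)
  rw [abs_le]
  constructor <;> linarith [le_abs_self (g v).toReal, neg_abs_le (g v).toReal]

/-- The combination is compared with a genuine recovery sequence `w` of the same point. Their
difference `d` tends to zero with `B d d` bounded, so all slopes along `d` vanish in the limit;
these force `B d d → 0`, and the two sequences of values have the same limit. -/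
theorem recovers_combo (h : IsQuadEpilimit B l g) {u u' : ∀ k, V k} {v v' : E}
    (hu : Recovers B l g u v) (hu' : Recovers B l g u' v') (s t : ℝ) :
    Recovers B l g (fun k => s • u k + t • u' k) (s • v + t • v') := by
  have hlim : Tendsto (fun k => ((s • u k + t • u' k : V k) : E)) atTop (𝓝 (s • v + t • v')) := by
    simpa using (hu.tendsto.const_smul s).add (hu'.tendsto.const_smul t)
  have hbd := h.bounded_quad_combo (h.bounded_quad hu) (h.bounded_quad hu') s t
  have htop : g (s • v + t • v') ≠ ⊤ := by
    intro htop
    obtain ⟨M, hM⟩ := hbd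
    obtain ⟨N, hN⟩ := h.bounded_linear hu
    obtain ⟨N', hN'⟩ := h.bounded_linear hu'
    -- An infinite limit would push the values above the bound that the quadratic and linear parts
    -- obey.
    have := h.lower _ _ hlim (M + |s| * N + |t| * N') (by rw [htop]; exact EReal.coe_lt_top _)
    obtain ⟨k, h1, h2, h3, h4⟩ := (hM.and (hN.and (hN'.and this))).exists
    rw [map_add (l k), map_smul (l k), map_smul (l k), smul_eq_mul, smul_eq_mul] at h4
    have h5 : s * l k (u k) ≤ |s| * N := by
      refine (le_abs_self _).trans ?_
      rw [abs_mul]; gcongr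
    have h6 : t * l k (u' k) ≤ |t| * N' := by
      refine (le_abs_self _).trans ?_
      rw [abs_mul]; gcongr
    linarith
  refine ⟨hlim, htop, ?_⟩
  obtain ⟨w, hw, hwval⟩ := h.recovery _ htop
  have hw' : Recovers B l g w (s • v + t • v') := ⟨hw, htop, hwval⟩
  obtain ⟨d, hd⟩ : ∃ d : ∀ k, V k, d = fun k => (1 : ℝ) • w k + (-1 : ℝ) • (s • u k + t • u' k) :=
    ⟨_, rfl⟩
  have hd' : ∀ k, s • u k + t • u' k = w k - d k := fun k => by rw [hd]; module
  have hd0 : Tendsto (fun k => (d k : E)) atTop (𝓝 0) := by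
    have := (hw.const_smul (1 : ℝ)).add (hlim.const_smul (-1 : ℝ))
    rw [one_smul, neg_one_smul, add_neg_cancel] at this
    simpa [hd] using this
  obtain ⟨M, hM⟩ := h.bounded_quad_combo (h.bounded_quad hw') hbd 1 (-1)
  have hM' : ∀ᶠ k in atTop, B k (d k) (d k) ≤ M := by rw [hd]; exact hM
  -- The slope at the zero sequence is `l k (d k)` alone; subtracting it from the other slopes
  -- isolates `B`.
  have l0 := h.slope_tendsto_zero h.recovers_zero hd0 hM'
  have lw := h.slope_tendsto_zero hw' hd0 hM'
  have lu := h.slope_tendsto_zero hu hd0 hM'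
  have lu' := h.slope_tendsto_zero hu' hd0 hM'
  -- `B d d` is a combination of the four slopes
  have hq : Tendsto (fun k => B k (d k) (d k)) atTop (𝓝 0) := by
    have := (((lw.sub l0).sub ((lu.sub l0).const_mul s)).sub
      ((lu'.sub l0).const_mul t)).const_mul (1 / 2 : ℝ)
    simp only [sub_zero, mul_zero] at this
    refine this.congr fun k => ?_
    have hdk : B k (d k) (d k) = B k (w k - (s • u k + t • u' k)) (d k) := by
      rw [hd' k, sub_sub_cancel]
    rw [hdk]
    simp only [map_add, map_sub, map_smul, LinearMap.add_apply, LinearMap.sub_apply,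
      LinearMap.smul_apply, smul_eq_mul, map_zero, LinearMap.zero_apply]
    ring
  have := (hwval.sub lw).add hq
  simp only [sub_zero, add_zero] at this
  refine this.congr fun k => ?_
  rw [hd' k]
  simp only [map_sub, LinearMap.sub_apply, h.symm k (d k) (w k)]
  ring

theorem tendsto_linear (h : IsQuadEpilimit B l g) {u : ∀ k, V k} {v : E}
    (hu : Recovers B l g u v) : ∃ r, Tendsto (fun k => l k (u k)) atTop (𝓝 r) := by
  have h2 := h.recovers_combo hu hu (1 / 2) 0
  refine ⟨_, ((h2.tendsto_val.const_mul 4).sub hu.tendsto_val).congr fun k => ?_⟩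
  simp only [zero_smul, add_zero, map_smul, LinearMap.smul_apply, smul_eq_mul]
  ring

theorem tendsto_bilin (h : IsQuadEpilimit B l g) {u u' : ∀ k, V k} {v v' : E}
    (hu : Recovers B l g u v) (hu' : Recovers B l g u' v') :
    ∃ r, Tendsto (fun k => B k (u k) (u' k)) atTop (𝓝 r) := by
  have h2 := h.recovers_combo hu hu' 1 1
  refine ⟨_, (((h2.tendsto_val.sub hu.tendsto_val).sub hu'.tendsto_val).const_mul (1 / 2)).congr
    fun k => ?_⟩
  simp only [one_smul, map_add, LinearMap.add_apply, h.symm k (u' k) (u k)]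
  ring

/-- Recovery sequences of the same point are asymptotically indistinguishable for `B`. -/
theorem tendsto_bilin_unique (h : IsQuadEpilimit B l g) {u u' w : ∀ k, V k} {v v' : E}
    (hu : Recovers B l g u v) (hu' : Recovers B l g u' v) (hw : Recovers B l g w v') {r r' : ℝ}
    (hr : Tendsto (fun k => B k (u k) (w k)) atTop (𝓝 r))
    (hr' : Tendsto (fun k => B k (u' k) (w k)) atTop (𝓝 r')) : r = r' := by
  obtain ⟨M, hM⟩ := h.bounded_quad_combo (h.bounded_quad hu) (h.bounded_quad hu') 1 (-1)
  have hd0 : Tendsto (fun k => (((1 : ℝ) • u k + (-1 : ℝ) • u' k : V k) : E)) atTop (𝓝 0) := by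
    have := (hu.tendsto.const_smul (1 : ℝ)).add (hu'.tendsto.const_smul (-1 : ℝ))
    rw [one_smul, neg_one_smul, add_neg_cancel] at this
    simpa using this
  have lw := h.slope_tendsto_zero hw hd0 hM
  have l0 := h.slope_tendsto_zero h.recovers_zero hd0 hM
  refine sub_eq_zero.1 (tendsto_nhds_unique (hr.sub hr') ?_)
  have := (lw.sub l0).const_mul (1 / 2 : ℝ)
  simp only [sub_zero, mul_zero] at this
  refine this.congr fun k => ?_
  simp only [map_add, map_smul, map_zero, LinearMap.zero_apply, smul_eq_mul, h.symm k (w k),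
    LinearMap.add_apply, LinearMap.smul_apply]
  ring

theorem tendsto_linear_unique (h : IsQuadEpilimit B l g) {u u' : ∀ k, V k} {v : E}
    (hu : Recovers B l g u v) (hu' : Recovers B l g u' v) {r r' : ℝ}
    (hr : Tendsto (fun k => l k (u k)) atTop (𝓝 r))
    (hr' : Tendsto (fun k => l k (u' k)) atTop (𝓝 r')) : r = r' := by
  obtain ⟨M, hM⟩ := h.bounded_quad_combo (h.bounded_quad hu) (h.bounded_quad hu') 1 (-1)
  have hd0 : Tendsto (fun k => (((1 : ℝ) • u k + (-1 : ℝ) • u' k : V k) : E)) atTop (𝓝 0) := by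
    have := (hu.tendsto.const_smul (1 : ℝ)).add (hu'.tendsto.const_smul (-1 : ℝ))
    rw [one_smul, neg_one_smul, add_neg_cancel] at this
    simpa using this
  have l0 := h.slope_tendsto_zero h.recovers_zero hd0 hM
  refine sub_eq_zero.1 (tendsto_nhds_unique (hr.sub hr') (l0.congr fun k => ?_))
  simp only [map_add, map_smul, map_zero, LinearMap.zero_apply, smul_eq_mul]
  ring

/-- The effective domain of a limit of quadratic functions. -/
def domain (h : IsQuadEpilimit B l g) : Submodule ℝ E where
  carrier := {v | g v ≠ ⊤}
  zero_mem' := h.recovers_zero.ne_top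
  add_mem' := fun {v v'} hv hv' => by
    obtain ⟨u, hu, hu2⟩ := h.recovery v hv
    obtain ⟨u', hu', hu2'⟩ := h.recovery v' hv'
    simpa using (h.recovers_combo ⟨hu, hv, hu2⟩ ⟨hu', hv', hu2'⟩ 1 1).ne_top
  smul_mem' := fun s v hv => by
    obtain ⟨u, hu, hu2⟩ := h.recovery v hv
    simpa using (h.recovers_combo ⟨hu, hv, hu2⟩ ⟨hu, hv, hu2⟩ s 0).ne_top

/-- An epilimit of convex quadratic functions on subspaces is of the same kind. -/
theorem exists_eq_quadExt (h : IsQuadEpilimit B l g) :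
    ∃ (W : Submodule ℝ E) (C : W →ₗ[ℝ] W →ₗ[ℝ] ℝ) (m : W →ₗ[ℝ] ℝ),
      (∀ x y, C x y = C y x) ∧ (∀ x, 0 ≤ C x x) ∧ ((∀ k, l k = 0) → m = 0) ∧
      g = quadExt W C m := by
  have hrec : ∀ v : h.domain, ∃ u : ∀ k, V k, Recovers B l g u v := fun v => by
    obtain ⟨u, hu, hu2⟩ := h.recovery v v.2
    exact ⟨u, hu, v.2, hu2⟩
  choose u hu using hrec
  choose m hm using fun v => h.tendsto_linear (hu v)
  choose C hC using fun v w => h.tendsto_bilin (hu v) (hu w)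
  have hsymm : ∀ v w, C v w = C w v := fun v w =>
    tendsto_nhds_unique (hC v w) ((hC w v).congr fun k => h.symm k _ _)
  have hadd : ∀ v v' w, C (v + v') w = C v w + C v' w := fun v v' w => by
    have h2 := h.recovers_combo (hu v) (hu v') 1 1
    rw [one_smul, one_smul] at h2
    refine h.tendsto_bilin_unique (hu (v + v')) h2 (hu w) (hC _ _)
      (((hC v w).add (hC v' w)).congr fun k => ?_)
    simp
  have hsmul : ∀ (s : ℝ) v w, C (s • v) w = s • C v w := fun s v w => by
    have h2 := h.recovers_combo (hu v) (hu v) s 0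
    rw [zero_smul, add_zero] at h2
    refine h.tendsto_bilin_unique (hu (s • v)) h2 (hu w) (hC _ _)
      (((hC v w).const_mul s).congr fun k => ?_)
    simp
  refine ⟨h.domain, LinearMap.mk₂ ℝ C hadd hsmul (fun v w w' => by
      rw [hsymm, hadd, hsymm v, hsymm v]) (fun s v w => by rw [hsymm, hsmul, hsymm v]),
    { toFun := m, map_add' := fun v v' => ?_, map_smul' := fun s v => ?_ },
    hsymm, fun v => ge_of_tendsto' (hC v v) fun k => h.nonneg k _, fun hl => ?_, ?_⟩
  · have h2 := h.recovers_combo (hu v) (hu v') 1 1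
    rw [one_smul, one_smul] at h2
    refine h.tendsto_linear_unique (hu (v + v')) h2 (hm _)
      (((hm v).add (hm v')).congr fun k => ?_)
    simp
  · have h2 := h.recovers_combo (hu v) (hu v) s 0
    rw [zero_smul, add_zero] at h2
    refine h.tendsto_linear_unique (hu (s • v)) h2 (hm _)
      (((hm v).const_mul s).congr fun k => ?_)
    simp
  · ext v
    refine tendsto_nhds_unique (hm v) (tendsto_const_nhds.congr fun k => ?_)
    simp [hl k]
  · funext v
    by_cases hv : g v = ⊤
    · rw [hv, quadExt_of_notMem]
      exact fun hv' => hv' hv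
    · lift v to h.domain using hv
      rw [quadExt_of_mem, ← EReal.coe_toReal v.2 (h.ne_bot v)]
      exact congrArg _ (tendsto_nhds_unique (hu v).tendsto_val ((hC v v).add (hm v)))

end IsQuadEpilimit

end QuadraticSequences

variable {n : ℕ}

/-! ### Quadratic forms on subspaces and symmetric linear relations -/

section Representation

/-- `q_A` is a quadratic form on a subspace, extended by `∞`. -/
theorem IsMaxMonoSymmLinRel.exists_q_eq_quadExt {A : Op n} (hA : IsMaxMonoSymmLinRel A) :
    ∃ (V : Submodule ℝ (Rn n)) (C : V →ₗ[ℝ] V →ₗ[ℝ] ℝ),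
      (∀ x y, C x y = C y x) ∧ (∀ x, 0 ≤ C x x) ∧ q A = quadExt V C 0 := by
  have hl := hA.linear
  have hm := hA.maximallyMonotone.1
  have hs := hA.symmetric
  obtain ⟨S, rfl⟩ := hA.linear
  -- A linear section of the projection to the domain: a linear choice of `u ∈ A x`, which makes
  -- `⟪x, T y⟫` bilinear.
  obtain ⟨T, hT⟩ := ((LinearMap.fst ℝ (Rn n) (Rn n)).submoduleMap S).exists_rightInverse_of_surjective
    (LinearMap.range_eq_top.2 (LinearMap.submoduleMap_surjective _ S))
  have hTfst : ∀ x, (T x : Rn n × Rn n).1 = x := fun x =>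
    congrArg Subtype.val (LinearMap.congr_fun hT x)
  have hTmem : ∀ x : S.map (LinearMap.fst ℝ (Rn n) (Rn n)), ((x : Rn n), (T x : Rn n × Rn n).2) ∈ (S : Set (Rn n × Rn n)) := fun x => by
    have := (T x).2
    rwa [← Prod.mk.eta (p := (T x : Rn n × Rn n)), hTfst] at this
  refine ⟨S.map (LinearMap.fst ℝ (Rn n) (Rn n)),
    LinearMap.mk₂ ℝ (fun x y => 1 / 2 * ⟪(x : Rn n), (T y : Rn n × Rn n).2⟫_ℝ)
      (fun x x' y => by simp [inner_add_left, mul_add])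
      (fun s x y => by simp [real_inner_smul_left, mul_left_comm])
      (fun x y y' => by simp [inner_add_right, mul_add])
      (fun s x y => by simp [real_inner_smul_right, mul_left_comm]), fun x y => ?_, fun x => ?_, ?_⟩
  · have := hs _ (hTmem y) _ _ (hTmem x)
    simp only [LinearMap.mk₂_apply]
    rw [this, real_inner_comm]
  · have := hm _ _ _ _ (hTmem x) S.zero_mem
    rw [sub_zero, sub_zero, real_inner_comm] at this
    exact mul_nonneg (by norm_num) this
  · funext x
    by_cases hx : x ∈ S.map (LinearMap.fst ℝ (Rn n) (Rn n))
    · lift x to S.map (LinearMap.fst ℝ (Rn n) (Rn n)) using hx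
      rw [quadExt_of_mem, q_eq hl hm (hTmem x)]
      simp
    · rw [quadExt_of_notMem _ _ hx, q_eq_top]
      rintro ⟨u, hu⟩
      exact hx ⟨(x, u), hu, rfl⟩

/-- The linear relation whose `q` is the form `C` on `V`, extended by `∞`. -/
def relOfForm (V : Submodule ℝ (Rn n)) (C : V →ₗ[ℝ] V →ₗ[ℝ] ℝ) : Op n :=
  {p | ∃ x : V, p.1 = x ∧ ∀ w : V, ⟪p.2, (w : Rn n)⟫_ℝ = 2 * C x w}

variable {V : Submodule ℝ (Rn n)} {C : V →ₗ[ℝ] V →ₗ[ℝ] ℝ}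

/-- Every linear form on a subspace is represented by a vector. -/
theorem exists_inner_eq (l : V →ₗ[ℝ] ℝ) : ∃ b : Rn n, ∀ w : V, ⟪b, (w : Rn n)⟫_ℝ = l w := by
  refine ⟨((InnerProductSpace.toDual ℝ V).symm (LinearMap.toContinuousLinearMap l) : V),
    fun w => ?_⟩
  rw [← Submodule.coe_inner, InnerProductSpace.toDual_symm_apply]
  rfl

theorem exists_mem_relOfForm (C : V →ₗ[ℝ] V →ₗ[ℝ] ℝ) (x : V) :
    ∃ u, ((x : Rn n), u) ∈ relOfForm V C := by
  obtain ⟨u, hu⟩ := exists_inner_eq ((2 : ℝ) • C x)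
  exact ⟨u, x, rfl, hu⟩

theorem isLinearRelation_relOfForm (C : V →ₗ[ℝ] V →ₗ[ℝ] ℝ) :
    IsLinearRelation (relOfForm V C) := by
  refine ⟨{ carrier := relOfForm V C, add_mem' := ?_, zero_mem' := ?_, smul_mem' := ?_ }, rfl⟩
  · rintro ⟨_, u⟩ ⟨_, u'⟩ ⟨x, rfl, hu⟩ ⟨x', rfl, hu'⟩
    refine ⟨x + x', rfl, fun w => ?_⟩
    simp only [Prod.mk_add_mk, inner_add_left, map_add, LinearMap.add_apply] at hu hu' ⊢
    rw [hu, hu', mul_add]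
  · exact ⟨0, rfl, fun w => by simp⟩
  · rintro s ⟨_, u⟩ ⟨x, rfl, hu⟩
    refine ⟨s • x, rfl, fun w => ?_⟩
    simp only [Prod.smul_mk, real_inner_smul_left, map_smul, LinearMap.smul_apply,
      smul_eq_mul] at hu ⊢
    rw [hu, mul_left_comm]

theorem isMonotone_relOfForm (hC : ∀ x, 0 ≤ C x x) : IsMonotone (relOfForm V C) := by
  rintro _ u _ v ⟨x, rfl, hu⟩ ⟨y, rfl, hv⟩
  have h1 := hu (x - y)
  have h2 := hv (x - y)
  have h3 := hC (x - y)
  simp only [Submodule.coe_sub] at h1 h2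
  rw [inner_sub_left, h1, h2]
  rw [map_sub C, LinearMap.sub_apply] at h3
  linarith

/-- This is maximality. Testing against the points `(0, w)` with `w ∈ Vᗮ` forces `y ∈ V`; testing
against the points over `y + t • w` with `w ∈ V` gives `0 ≤ t * β + t ^ 2 * γ` for all `t`, hence `β
= 0`. -/
theorem mem_of_forall_monotone (hC : ∀ x, 0 ≤ C x x) {y v : Rn n}
    (h : ∀ x u, (x, u) ∈ relOfForm V C → 0 ≤ ⟪v - u, y - x⟫_ℝ) : (y, v) ∈ relOfForm V C := by
  have hy : y ∈ V := by
    rw [← V.orthogonal_orthogonal, Submodule.mem_orthogonal]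
    intro w hw
    by_contra hne
    -- The multiple is chosen so that the inner product in `h` equals `-1`.
    have := h 0 (((⟪v, y⟫_ℝ + 1) / ⟪w, y⟫_ℝ) • w) ⟨0, rfl, fun z => by
      rw [real_inner_smul_left, (Submodule.mem_orthogonal' V w).1 hw z z.2]; simp⟩
    rw [sub_zero, inner_sub_left, real_inner_smul_left, div_mul_cancel₀ _ hne] at this
    linarith
  lift y to V using hy
  refine ⟨y, rfl, fun w => ?_⟩
  set β : ℝ := 2 * C y w - ⟪v, (w : Rn n)⟫_ℝ with hβ
  set γ : ℝ := 2 * C w w with hγ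
  have hγ0 : 0 ≤ γ := mul_nonneg zero_le_two (hC w)
  have key : ∀ t : ℝ, 0 ≤ t * β + t ^ 2 * γ := fun t => by
    obtain ⟨u, hu⟩ := exists_mem_relOfForm C (y + t • w)
    have h1 := h _ _ hu
    obtain ⟨x, hx, hu⟩ := hu
    obtain rfl : y + t • w = x := Subtype.ext hx
    have h2 := hu w
    simp only [Submodule.coe_add, Submodule.coe_smul, sub_add_cancel_left, inner_neg_right,
      real_inner_smul_right, inner_sub_left, map_add, map_smul, LinearMap.add_apply,
      LinearMap.smul_apply, smul_eq_mul] at h1 h2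
    rw [h2] at h1
    rw [hβ, hγ]
    linarith
  have h1 := key (-β / (γ + 1))
  have h2 : -β / (γ + 1) * β + (-β / (γ + 1)) ^ 2 * γ = -(β / (γ + 1)) ^ 2 := by
    field_simp; ring
  have h3 : β / (γ + 1) = 0 := by
    rw [h2] at h1
    exact pow_eq_zero_iff two_ne_zero |>.1 (le_antisymm (by linarith) (sq_nonneg _))
  have h4 : β = 0 := (div_eq_zero_iff.1 h3).resolve_right (by positivity)
  rw [hβ] at h4
  linarith

theorem isMaxMonoSymmLinRel_relOfForm (hs : ∀ x y, C x y = C y x) (hC : ∀ x, 0 ≤ C x x) :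
    IsMaxMonoSymmLinRel (relOfForm V C) where
  linear := isLinearRelation_relOfForm C
  maximallyMonotone := ⟨isMonotone_relOfForm hC, fun B hB hAB => Set.Subset.antisymm
    (fun p hp => mem_of_forall_monotone hC fun x u hu => hB _ _ _ _ hp (hAB _ hu)) hAB⟩
  symmetric := by
    rintro ⟨_, u⟩ ⟨x, rfl, hu⟩ _ v ⟨y, rfl, hv⟩
    exact (real_inner_comm _ _).trans ((hu y).trans (by rw [hs, hv x]))

theorem q_relOfForm (hC : ∀ x, 0 ≤ C x x) : q (relOfForm V C) = quadExt V C 0 := by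
  funext x
  by_cases hx : x ∈ V
  · lift x to V using hx
    obtain ⟨u, hu⟩ := exists_mem_relOfForm C x
    rw [q_eq (isLinearRelation_relOfForm C) (isMonotone_relOfForm hC) hu, quadExt_of_mem]
    obtain ⟨y, hy, hu⟩ := hu
    obtain rfl : x = y := Subtype.ext hy
    rw [real_inner_comm, hu x]
    simp
  · rw [quadExt_of_notMem _ _ hx, q_eq_top]
    rintro ⟨u, y, rfl, -⟩
    exact hx y.2

end Representation

/-! ### From epiconvergence to quadratic epilimits -/

section Epiconvergence

variable {fk : ℕ → Rn n → EReal} {f : Rn n → EReal}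

theorem EpiConverges.eventually_lt (h : EpiConverges fk f) {z : ℕ → Rn n} {x : Rn n}
    (hz : Tendsto z atTop (𝓝 x)) {s : ℝ} (hs : (s : EReal) < f x) :
    ∀ᶠ k in atTop, (s : EReal) < fk k (z k) := by
  by_contra hne
  have hfreq : ∃ᶠ k in atTop, fk k (z k) ≤ s := by simpa [Filter.Frequently] using hne
  have hmem : (x, s) ∈ epi f := by
    rw [h.1]
    intro U hU
    have hlim : Tendsto (fun k => (z k, s)) atTop (𝓝 (x, s)) := hz.prodMk_nhds tendsto_const_nhds
    exact (hfreq.and_eventually (hlim hU)).mono fun k hk => ⟨_, hk.1, hk.2⟩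
  exact not_le_of_gt hs hmem

theorem EpiConverges.exists_recovery (h : EpiConverges fk f) (hne : ∀ k, (epi (fk k)).Nonempty)
    {x : Rn n} {r : ℝ} (hx : f x = r) :
    ∃ (z : ℕ → Rn n) (ρ : ℕ → ℝ), Tendsto z atTop (𝓝 x) ∧ Tendsto ρ atTop (𝓝 r) ∧
      ∀ k, fk k (z k) ≤ ρ k := by
  have hmem : (x, r) ∈ innerLimit fun k => epi (fk k) := by
    rw [← h.2]
    exact hx.le
  -- Near-projections of `(x, r)` onto the epigraphs; the slack `1 / (k + 1)` avoids having to
  -- attain the distance.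
  have hdist : ∀ k : ℕ, ∃ p ∈ epi (fk k),
      dist (x, r) p < Metric.infDist (x, r) (epi (fk k)) + 1 / ((k : ℝ) + 1) := fun k =>
    (Metric.infDist_lt_iff (hne k)).1 (lt_add_of_pos_right _ Nat.one_div_pos_of_nat)
  choose p hp hpd using hdist
  have hinf : Tendsto (fun k => Metric.infDist (x, r) (epi (fk k))) atTop (𝓝 0) := by
    refine Metric.tendsto_nhds.2 fun ε hε => ?_
    filter_upwards [hmem _ (Metric.ball_mem_nhds _ hε)] with k ⟨y, hy, hyb⟩
    rw [Real.dist_eq, sub_zero, abs_of_nonneg Metric.infDist_nonneg]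
    exact (Metric.infDist_le_dist_of_mem hy).trans_lt (by rwa [dist_comm])
  have hlim : Tendsto p atTop (𝓝 (x, r)) := by
    have h0 := hinf.add (tendsto_one_div_add_atTop_nhds_zero_nat (𝕜 := ℝ))
    rw [add_zero] at h0
    refine tendsto_iff_dist_tendsto_zero.2 (squeeze_zero (fun _ => dist_nonneg) (fun k => ?_) h0)
    rw [dist_comm]
    exact (hpd k).le
  exact ⟨fun k => (p k).1, fun k => (p k).2, (continuous_fst.tendsto _).comp hlim,
    (continuous_snd.tendsto _).comp hlim, hp⟩

/-- Along a sequence with values bounded by a recovery sequence, the values converge. -/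
theorem EpiConverges.tendsto_of_le (h : EpiConverges fk f) {z : ℕ → Rn n} {x : Rn n} {r : ℝ}
    {ρ γ : ℕ → ℝ} (hz : Tendsto z atTop (𝓝 x)) (hx : f x = r) (hρ : Tendsto ρ atTop (𝓝 r))
    (hγ : ∀ k, fk k (z k) = γ k) (hle : ∀ k, γ k ≤ ρ k) : Tendsto γ atTop (𝓝 r) := by
  refine tendsto_order.2 ⟨fun s hs => ?_, fun s hs => ?_⟩
  · filter_upwards [h.eventually_lt hz (s := s) (by rw [hx]; exact_mod_cast hs)] with k hk
    rw [hγ] at hk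
    exact_mod_cast hk
  · filter_upwards [hρ.eventually_lt_const hs] with k hk
    exact (hle k).trans_lt hk

variable {V : ℕ → Submodule ℝ (Rn n)} {C : ∀ k, V k →ₗ[ℝ] V k →ₗ[ℝ] ℝ} {l : ∀ k, V k →ₗ[ℝ] ℝ}

theorem isQuadEpilimit_of_epiConverges (hs : ∀ k x y, C k x y = C k y x)
    (hC : ∀ k x, 0 ≤ C k x x) {γ : ℕ → ℝ} {p : ℕ → Rn n} {x : Rn n} {r : ℝ}
    (hfk : ∀ k v, fk k (p k + v) = (γ k : EReal) + quadExt (V k) (C k) (l k) v)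
    (hepi : EpiConverges fk f) (hf : IsProper f) (hp : Tendsto p atTop (𝓝 x))
    (hγ : Tendsto γ atTop (𝓝 r)) (hx : f x = r) :
    IsQuadEpilimit C l (fun v => f (x + v) - (r : EReal)) where
  symm := hs
  nonneg := hC
  zero := by
    rw [add_zero, hx, ← EReal.coe_sub, sub_self, EReal.coe_zero]
  ne_bot v := by
    have := hf.1 (x + v)
    induction hv : f (x + v) with
    | bot => exact absurd hv this
    | top => simp
    | coe y => rw [← EReal.coe_sub]; exact EReal.coe_ne_bot _
  lower u v hu s hsv := by
    -- The gap between `s` and `s'` absorbs the error `γ k - r`.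
    obtain ⟨s', hs1, hs2⟩ : ∃ s' : ℝ, s < s' ∧ ((s' + r : ℝ) : EReal) < f (x + v) := by
      obtain ⟨s', h1, h2⟩ := EReal.lt_iff_exists_real_btwn.1 hsv
      refine ⟨s', by exact_mod_cast h1, ?_⟩
      rw [EReal.coe_add]
      exact EReal.add_lt_of_lt_sub h2
    filter_upwards [hepi.eventually_lt (hp.add hu) hs2,
      hγ.eventually_lt_const (u := r + (s' - s)) (by linarith)] with k hk hk'
    rw [hfk, quadExt_of_mem, ← EReal.coe_add, EReal.coe_lt_coe_iff] at hk
    linarith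
  recovery v hv := by
    have hv' : f (x + v) ≠ ⊤ := fun htop => hv (by rw [htop]; exact EReal.top_sub_coe r)
    have hfv := (EReal.coe_toReal hv' (hf.1 _)).symm
    have hne : ∀ k, (epi (fk k)).Nonempty := fun k => ⟨(p k, γ k), by
      have := hfk k 0
      rw [← (V k).coe_zero, quadExt_of_mem] at this
      simpa [epi] using this.le⟩
    obtain ⟨z, ρ, hz, hρ, hle⟩ := hepi.exists_recovery hne hfv
    have hmem : ∀ k, z k - p k ∈ V k := fun k => by
      by_contra hk
      have := hfk k (z k - p k)
      rw [quadExt_of_notMem _ _ hk, EReal.coe_add_top, add_sub_cancel] at this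
      have h2 := hle k
      rw [this] at h2
      exact EReal.coe_ne_top _ (top_le_iff.1 h2)
    obtain ⟨u, hu⟩ : ∃ u : ∀ k, V k, ∀ k, (u k : Rn n) = z k - p k :=
      ⟨fun k => ⟨_, hmem k⟩, fun k => rfl⟩
    have hval : ∀ k, fk k (z k) = ((γ k + (C k (u k) (u k) + l k (u k)) : ℝ) : EReal) := fun k => by
      rw [EReal.coe_add, ← quadExt_of_mem, ← hfk, hu, add_sub_cancel]
    refine ⟨u, ?_, ?_⟩
    · simpa [hu] using hz.sub hp
    · have := hepi.tendsto_of_le hz hfv hρ hval fun k => by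
        have := hle k
        rw [hval k] at this
        exact_mod_cast this
      have h2 := this.sub hγ
      simp only [add_sub_cancel_left] at h2
      rw [hfv, ← EReal.coe_sub, EReal.toReal_coe]
      simpa using h2

theorem exists_eq_add_quadExt (hs : ∀ k x y, C k x y = C k y x)
    (hC : ∀ k x, 0 ≤ C k x x) {γ : ℕ → ℝ} {p : ℕ → Rn n} {x : Rn n} {r : ℝ}
    (hfk : ∀ k v, fk k (p k + v) = (γ k : EReal) + quadExt (V k) (C k) (l k) v)
    (hepi : EpiConverges fk f) (hf : IsProper f) (hp : Tendsto p atTop (𝓝 x))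
    (hγ : Tendsto γ atTop (𝓝 r)) (hx : f x = r) :
    ∃ (A : Op n) (b : Rn n), IsMaxMonoSymmLinRel A ∧ ((∀ k, l k = 0) → b = 0) ∧
      f = genLinQuad A x b (r - ⟪b, x⟫_ℝ) := by
  obtain ⟨W, D, m, hDs, hD, hm, hg⟩ :=
    (isQuadEpilimit_of_epiConverges hs hC hfk hepi hf hp hγ hx).exists_eq_quadExt
  -- A representing vector is unique only modulo `Wᗮ`, so `b = 0` must be selected explicitly when
  -- `m = 0`.
  obtain ⟨b, hb, hb0⟩ : ∃ b : Rn n, (∀ w : W, ⟪b, (w : Rn n)⟫_ℝ = m w) ∧ (m = 0 → b = 0) := by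
    by_cases hm0 : m = 0
    · exact ⟨0, by simp [hm0], fun _ => rfl⟩
    · obtain ⟨b, hb⟩ := exists_inner_eq m
      exact ⟨b, hb, fun h => absurd h hm0⟩
  refine ⟨relOfForm W D, b, isMaxMonoSymmLinRel_relOfForm hDs hD, fun h => hb0 (hm h), ?_⟩
  funext y
  have hy := congrFun hg (y - x)
  simp only [add_sub_cancel] at hy
  rw [genLinQuad, q_relOfForm hD]
  by_cases hmem : y - x ∈ W
  · obtain ⟨w, hw⟩ : ∃ w : W, (w : Rn n) = y - x := ⟨⟨_, hmem⟩, rfl⟩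
    have hbw := hb w
    rw [← hw, quadExt_of_mem] at hy ⊢
    rw [hw, inner_sub_right] at hbw
    have hfy : f y ≠ ⊤ := fun h => by
      rw [h, EReal.top_sub_coe] at hy
      exact EReal.coe_ne_top _ hy.symm
    rw [← EReal.coe_toReal hfy (hf.1 y)] at hy ⊢
    norm_cast at hy ⊢
    rw [LinearMap.zero_apply]
    linarith
  · rw [quadExt_of_notMem _ _ hmem] at hy ⊢
    rw [EReal.top_add_coe, EReal.top_add_coe]
    by_contra hfy
    rw [← EReal.coe_toReal hfy (hf.1 y), ← EReal.coe_sub] at hy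
    exact EReal.coe_ne_top _ hy

theorem exists_genLinQuad_of_epiConverges {A : ℕ → Op n} {a b : ℕ → Rn n} {c : ℕ → ℝ}
    (hA : ∀ k, IsMaxMonoSymmLinRel (A k)) (hfk : ∀ k, fk k = genLinQuad (A k) (a k) (b k) (c k))
    (hepi : EpiConverges fk f) (hf : IsProper f) :
    ∃ (A' : Op n) (a' b' : Rn n) (c' : ℝ),
      IsMaxMonoSymmLinRel A' ∧ f = genLinQuad A' a' b' c' := by
  choose V C hs hC hq using fun k => (hA k).exists_q_eq_quadExt
  have hval : ∀ k (e : V k), fk k (a k + e) =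
      ((C k e e + ⟪b k, a k + e⟫_ℝ + c k : ℝ) : EReal) := fun k e => by
    rw [hfk, genLinQuad, hq, add_sub_cancel_left, quadExt_of_mem]
    norm_cast
    simp
  have htop : ∀ k y, y ∉ V k → fk k (a k + y) = ⊤ := fun k y hy => by
    rw [hfk, genLinQuad, hq, add_sub_cancel_left, quadExt_of_notMem _ _ hy, EReal.top_add_coe,
      EReal.top_add_coe]
  have hne : ∀ k, (epi (fk k)).Nonempty := fun k => ⟨(a k + (0 : V k), _), (hval k 0).le⟩
  obtain ⟨x, hx⟩ := hf.2
  have hfx := (EReal.coe_toReal hx (hf.1 x)).symm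
  obtain ⟨p, ρ, hp, hρ, hle⟩ := hepi.exists_recovery hne hfx
  have hmem : ∀ k, p k - a k ∈ V k := fun k => by
    by_contra hk
    have := htop k _ hk
    rw [add_sub_cancel] at this
    have h2 := hle k
    rw [this] at h2
    exact EReal.coe_ne_top _ (top_le_iff.1 h2)
  obtain ⟨e, he⟩ : ∃ e : ∀ k, V k, ∀ k, p k = a k + e k :=
    ⟨fun k => ⟨_, hmem k⟩, fun k => (add_sub_cancel _ _).symm⟩
  have hpval : ∀ k, fk k (p k) = ((C k (e k) (e k) + ⟪b k, a k + e k⟫_ℝ + c k : ℝ) : EReal) :=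
    fun k => by rw [he k, hval k (e k)]
  have hγ := hepi.tendsto_of_le hp hfx hρ hpval fun k => by
    have := hle k
    rw [hpval k] at this
    exact_mod_cast this
  -- Expansion about `e k`: the cross term `2 * C k (e k) v` joins `⟪b k, v⟫` in the linear part.
  have hfkp : ∀ k v, fk k (p k + v) =
      ((C k (e k) (e k) + ⟪b k, a k + e k⟫_ℝ + c k : ℝ) : EReal) + quadExt (V k) (C k)
        ((2 : ℝ) • C k (e k) + (innerₗ (Rn n) (b k)).domRestrict (V k)) v := fun k v => by
    rw [he k, add_assoc]
    by_cases hv : v ∈ V k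
    · lift v to V k using hv
      rw [← Submodule.coe_add, hval, quadExt_of_mem, ← EReal.coe_add]
      congr 1
      simp only [map_add, LinearMap.add_apply, LinearMap.smul_apply, smul_eq_mul,
        LinearMap.domRestrict_apply, innerₗ_apply_apply, Submodule.coe_add, inner_add_right,
        hs k v (e k)]
      ring
    · rw [htop k _ (fun h => hv (((V k).add_mem_iff_right (e k).2).1 h)),
        quadExt_of_notMem _ _ hv, EReal.coe_add_top]
  obtain ⟨A', b', hA', -, hfA⟩ := exists_eq_add_quadExt hs hC hfkp hepi hf hp hγ hfx
  exact ⟨A', x, b', _, hA', hfA⟩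

theorem exists_q_add_const_of_epiConverges {A : ℕ → Op n} {c : ℕ → ℝ}
    (hA : ∀ k, IsMaxMonoSymmLinRel (A k)) (hfk : ∀ k, fk k = fun x => q (A k) x + (c k : EReal))
    (hepi : EpiConverges fk f) (hf : IsProper f) :
    ∃ (A' : Op n) (c' : ℝ), IsMaxMonoSymmLinRel A' ∧ f = fun x => q A' x + (c' : EReal) := by
  choose V C hs hC hq using fun k => (hA k).exists_q_eq_quadExt
  have hval : ∀ k v, fk k (0 + v) = (c k : EReal) + quadExt (V k) (C k) 0 v := fun k v => by
    rw [zero_add, hfk, hq, add_comm]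
  have hzero : ∀ k, fk k 0 = c k := fun k => by
    have := hval k 0
    rw [← (V k).coe_zero, quadExt_of_mem] at this
    simpa using this
  have hmin : ∀ k v (ρ : ℝ), fk k v ≤ ρ → c k ≤ ρ := fun k v ρ h => by
    have hv := hval k v
    rw [zero_add] at hv
    by_cases hmem : v ∈ V k
    · lift v to V k using hmem
      rw [hv, quadExt_of_mem, ← EReal.coe_add, EReal.coe_le_coe_iff, LinearMap.zero_apply] at h
      linarith [hC k v]
    · rw [hv, quadExt_of_notMem _ _ hmem, EReal.coe_add_top] at h
      exact absurd (top_le_iff.1 h) (EReal.coe_ne_top _)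
  have hne : ∀ k, (epi (fk k)).Nonempty := fun k => ⟨(0, _), (hzero k).le⟩
  -- Each `fk k` has its minimum `c k` at `0`. If `f 0 = ⊤`, these minima would eventually exceed
  -- values recovering a finite `f x`.
  have h0 : f 0 ≠ ⊤ := fun h0 => by
    obtain ⟨x, hx⟩ := hf.2
    obtain ⟨z, ρ, -, hρ, hle⟩ := hepi.exists_recovery hne (EReal.coe_toReal hx (hf.1 x)).symm
    have h1 := hepi.eventually_lt (z := fun _ => 0) tendsto_const_nhds
      (s := (f x).toReal + 1) (by rw [h0]; exact EReal.coe_lt_top _)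
    obtain ⟨k, hk, hk'⟩ := (h1.and (hρ.eventually_lt_const (lt_add_one _))).exists
    rw [hzero, EReal.coe_lt_coe_iff] at hk
    linarith [hmin k _ _ (hle k)]
  have hf0 := (EReal.coe_toReal h0 (hf.1 0)).symm
  obtain ⟨z, ρ, -, hρ, hle⟩ := hepi.exists_recovery hne hf0
  have hc := hepi.tendsto_of_le tendsto_const_nhds hf0 hρ hzero fun k => hmin k _ _ (hle k)
  obtain ⟨A', b', hA', hb', hfA⟩ := exists_eq_add_quadExt hs hC hval hepi hf tendsto_const_nhds
    hc hf0
  refine ⟨A', (f 0).toReal, hA', hfA.trans ?_⟩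
  funext x
  simp [genLinQuad, hb' fun _ => rfl]

end Epiconvergence

end EpiQuad

theorem mainTheorem7 (n : ℕ) :
    (∀ (A : ℕ → EpiQuad.Op n) (a b : ℕ → EpiQuad.Rn n) (c : ℕ → ℝ)
        (fk : ℕ → EpiQuad.Rn n → EReal) (f : EpiQuad.Rn n → EReal),
      (∀ k, EpiQuad.IsMaxMonoSymmLinRel (A k)) →
      (∀ k, fk k = EpiQuad.genLinQuad (A k) (a k) (b k) (c k)) →
      EpiQuad.EpiConverges fk f → EpiQuad.IsProper f →
      ∃ (A' : EpiQuad.Op n) (a' b' : EpiQuad.Rn n) (c' : ℝ),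
        EpiQuad.IsMaxMonoSymmLinRel A' ∧ f = EpiQuad.genLinQuad A' a' b' c') ∧
    (∀ (A : ℕ → EpiQuad.Op n) (c : ℕ → ℝ)
        (fk : ℕ → EpiQuad.Rn n → EReal) (f : EpiQuad.Rn n → EReal),
      (∀ k, EpiQuad.IsMaxMonoSymmLinRel (A k)) →
      (∀ k, fk k = fun x => EpiQuad.q (A k) x + (c k : EReal)) →
      EpiQuad.EpiConverges fk f → EpiQuad.IsProper f →
      ∃ (A' : EpiQuad.Op n) (c' : ℝ),
        EpiQuad.IsMaxMonoSymmLinRel A' ∧ f = fun x => EpiQuad.q A' x + (c' : EReal)) :=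
  ⟨fun _ _ _ _ _ _ hA hfk hepi hf => EpiQuad.exists_genLinQuad_of_epiConverges hA hfk hepi hf,
    fun _ _ _ _ hA hfk hepi hf => EpiQuad.exists_q_add_const_of_epiConverges hA hfk hepi hf⟩
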